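/- Let $M$ be a connected smooth manifold of dimension $n>0$ with a smooth Riemannian metric $g$, and let $x: M\to\mathbb{E}^m$ be a smooth isometric immersion, that is, $\langle dx(X),dx(Y)\rangle=g(X,Y)$ for all tangent vectors $X,Y$. Let $H=\frac1n\operatorname{trace}h$ be its mean curvature vector field, where $h$ is the second fundamental form of $x$, and suppose that $H$ is parallel in the normal bundle: $DH=0$, where $D_XH$ is the normal component of the derivative of $H:M\to\mathbb{E}^m$ in the direction $X$. Let $\Delta=-\operatorname{trace}\nabla^2$ be the Laplace operator of $(M,g)$, acting componentwise on $\mathbb{E}^m$-valued functions, and let $L=\Delta x: M\to\mathbb{E}^m$ (so $L=-nH$, by Beltrami's formula). Call the Laplace transformation $\mathcal{L}:M\to L(M)$, $p\mapsto L(p)$, homothetic if there is a constant $c>0$ such that $\langle dL(X),dL(Y)\rangle=c^2 g(X,Y)$ for all $p\in M$ and all $X,Y\in T_pM$. Then the Laplace transformation of $x$ is homothetic if and only if $x$ immerses $M$ as a minimal submanifold of a hypersphere of $\mathbb{E}^m$, that is, if and only if there are $a\in\mathbb{E}^m$ and $r>0$ such that $\|x(p)-a\|=r$ for all $p\in M$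 and the mean curvature vector of $x$, as an immersion into the hypersphere with centre $a$ and radius $r$, vanishes identically. -/

import Mathlib

open scoped Manifold ContDiff

noncomputable section

namespace LaplaceTransformation

/-- Euclidean space `𝔼ᵏ`. -/
abbrev Euc (k : ℕ) : Type := EuclideanSpace ℝ (Fin k)

/-- The standard basis vectors of `𝔼ᵏ`. As a vector of `TangentSpace (𝓡 n) p`, the vector `stdVec i`
is the coordinate vector `∂ᵢ` at `p` of the preferred chart at `p`. -/
def stdVec {k : ℕ} (i : Fin k) : Euc k := EuclideanSpace.single i 1

/-- The partial derivative `∂ᵢ f` of a vector-valued function on `𝔼ᵏ`. -/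
def partialD {k : ℕ} {F : Type*} [NormedAddCommGroup F] [NormedSpace ℝ F]
    (i : Fin k) (f : Euc k → F) (z : Euc k) : F :=
  fderiv ℝ f z (stdVec i)

section

variable {n : ℕ} {M : Type*} [TopologicalSpace M] [ChartedSpace (Euc n) M]

/-- The expression of `f : M → F` in the preferred chart at `p`. -/
def inChart {F : Type*} (p : M) (f : M → F) : Euc n → F :=
  fun z => f ((extChartAt (𝓡 n) p).symm z)

variable [IsManifold (𝓡 n) ∞ M]

/-- A smooth Riemannian metric on the `n`-dimensional smooth manifold `M`. -/
abbrev RiemMetric (n : ℕ) (M : Type*) [TopologicalSpace M] [ChartedSpace (Euc n) M]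
    [IsManifold (𝓡 n) ∞ M] : Type _ :=
  Bundle.ContMDiffRiemannianMetric (𝓡 n) ∞ (Euc n) (fun p : M => TangentSpace (𝓡 n) p)

/-- The matrix `(gᵢⱼ)` of the metric at `p`, in the basis `∂₁, …, ∂ₙ` of the tangent space. -/
def gram (g : RiemMetric n M) (p : M) : Matrix (Fin n) (Fin n) ℝ :=
  Matrix.of fun i j =>
    g.inner p (stdVec i : TangentSpace (𝓡 n) p) (stdVec j : TangentSpace (𝓡 n) p)

/-- The trace `∑ gⁱʲ B(∂ᵢ, ∂ⱼ)`, with respect to the metric, of a (vector-valued) bilinear form `B`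
on the tangent space at `p`. -/
def metricTrace {F : Type*} [AddCommGroup F] [Module ℝ F] (g : RiemMetric n M) (p : M)
    (B : TangentSpace (𝓡 n) p → TangentSpace (𝓡 n) p → F) : F :=
  ∑ i : Fin n, ∑ j : Fin n, (gram g p)⁻¹ i j • B (stdVec i : Euc n) (stdVec j : Euc n)

/-- The coefficient functions `gᵢⱼ` of the metric in the preferred chart at `p`, as functions on the
target of that chart. -/
def metricCoeff (g : RiemMetric n M) (p : M) (i j : Fin n) (z : Euc n) : ℝ :=
  g.inner ((extChartAt (𝓡 n) p).symm z)
    (mfderiv 𝓘(ℝ, Euc n) (𝓡 n) (extChartAt (𝓡 n) p).symm z (stdVec i : Euc n))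
    (mfderiv 𝓘(ℝ, Euc n) (𝓡 n) (extChartAt (𝓡 n) p).symm z (stdVec j : Euc n))

/-- The Christoffel symbols at `p` of the Levi-Civita connection, in the preferred chart at `p`:
`Γᵏᵢⱼ = ½ ∑ₗ gᵏˡ (∂ᵢ gⱼₗ + ∂ⱼ gᵢₗ - ∂ₗ gᵢⱼ)`. -/
def christoffel (g : RiemMetric n M) (p : M) (k i j : Fin n) : ℝ :=
  (1 / 2 : ℝ) * ∑ l : Fin n, (gram g p)⁻¹ k l *
    (partialD i (metricCoeff g p j l) (extChartAt (𝓡 n) p p)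
      + partialD j (metricCoeff g p i l) (extChartAt (𝓡 n) p p)
      - partialD l (metricCoeff g p i j) (extChartAt (𝓡 n) p p))

/-- The coefficient `(∇²f)(∂ᵢ, ∂ⱼ) = ∂ᵢ∂ⱼ f - ∑ₖ Γᵏᵢⱼ ∂ₖ f` at `p` of the Hessian of `f`. -/
def hessian {F : Type*} [NormedAddCommGroup F] [NormedSpace ℝ F]
    (g : RiemMetric n M) (f : M → F) (p : M) (i j : Fin n) : F :=
  partialD i (partialD j (inChart p f)) (extChartAt (𝓡 n) p p)
    - ∑ k : Fin n, christoffel g p k i j • partialD k (inChart p f) (extChartAt (𝓡 n) p p)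

/-- The Laplace operator `Δ = - trace ∇²` of `(M, g)`, acting on vector-valued functions
(componentwise). -/
def laplacian {F : Type*} [NormedAddCommGroup F] [NormedSpace ℝ F]
    (g : RiemMetric n M) (f : M → F) (p : M) : F :=
  -∑ i : Fin n, ∑ j : Fin n, (gram g p)⁻¹ i j • hessian g f p i j

/-- `x` is a smooth isometric immersion of `(M, g)` into `𝔼ᵐ`: it is smooth and
`⟨dx(u), dx(v)⟩ = g(u, v)` for all tangent vectors. -/
def IsIsometricImmersion {m : ℕ} (g : RiemMetric n M) (x : M → Euc m) : Prop :=
  ContMDiff (𝓡 n) 𝓘(ℝ, Euc m) ∞ x ∧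
    ∀ (p : M) (u v : TangentSpace (𝓡 n) p),
      inner ℝ (mvfderiv (𝓡 n) x p u) (mvfderiv (𝓡 n) x p v) = g.inner p u v

/-- A map `L : M → 𝔼ᵐ`, as a transformation of `(M, g)` onto its image with the induced metric, is
homothetic: `⟨dL(u), dL(v)⟩ = c² g(u, v)` for a positive constant `c`. -/
def IsHomothetic {m : ℕ} (g : RiemMetric n M) (L : M → Euc m) : Prop :=
  ∃ c : ℝ, 0 < c ∧ ∀ (p : M) (u v : TangentSpace (𝓡 n) p),
    inner ℝ (mvfderiv (𝓡 n) L p u) (mvfderiv (𝓡 n) L p v) = c ^ 2 * g.inner p u v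

/-- The image `dx(T_pM)` of the tangent space at `p`. -/
def tangentImage (n : ℕ) {M : Type*} [TopologicalSpace M] [ChartedSpace (Euc n) M]
    {m : ℕ} (x : M → Euc m) (p : M) : Submodule ℝ (Euc m) :=
  LinearMap.range (mvfderiv (𝓡 n) x p).toLinearMap

/-- The normal space at `p` of an immersion `x` into a submanifold of `𝔼ᵐ` whose tangent space at
`x p` is `W`; for `W = ⊤` it is the normal space of `x` in `𝔼ᵐ`. -/
def normalSpace (n : ℕ) {M : Type*} [TopologicalSpace M] [ChartedSpace (Euc n) M]
    {m : ℕ} (W : Submodule ℝ (Euc m)) (x : M → Euc m) (p : M) :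
    Submodule ℝ (Euc m) :=
  W ⊓ (tangentImage n x p)ᗮ

/-- The second fundamental form at `p` of an immersion `x` into a submanifold of `𝔼ᵐ` whose tangent
space at `x p` is `W`: `h(u, v)` is the normal component of the derivative, in the direction `u`, of
`dx(V)`, for any extension `V` of `v`, here the one with constant coefficients in the preferred
chart at `p`. (The Levi-Civita connection of the submanifold is the tangential component of the flat
one, so the projection of the flat derivative onto the normal space is what is to be taken.) -/
def secondFundamentalForm {m : ℕ} (W : Submodule ℝ (Euc m)) (x : M → Euc m) (p : M)
    (u v : TangentSpace (𝓡 n) p) : Euc m :=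
  (normalSpace n W x p).starProjection
    (fderiv ℝ (fun z : Euc n => fderiv ℝ (inChart p x) z (v : Euc n))
      (extChartAt (𝓡 n) p p) (u : Euc n))

/-- The mean curvature vector `(1/n) trace h` at `p` of an immersion `x` into a submanifold of `𝔼ᵐ`
whose tangent space at `x p` is `W`. -/
def meanCurvatureVectorIn {m : ℕ} (g : RiemMetric n M) (W : Submodule ℝ (Euc m)) (x : M → Euc m)
    (p : M) : Euc m :=
  (1 / (n : ℝ)) • metricTrace g p (secondFundamentalForm W x p)

/-- The mean curvature vector field `H` of `x : M → 𝔼ᵐ`. -/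
def meanCurvatureVector {m : ℕ} (g : RiemMetric n M) (x : M → Euc m) (p : M) : Euc m :=
  meanCurvatureVectorIn g ⊤ x p

/-- The normal connection of `x : M → 𝔼ᵐ`: `D_u ξ` is the normal component of the derivative in the
direction `u` of the normal vector field `ξ`. -/
def normalDerivative {m : ℕ} (x ξ : M → Euc m) (p : M) (u : TangentSpace (𝓡 n) p) : Euc m :=
  (normalSpace n ⊤ x p).starProjection (mvfderiv (𝓡 n) ξ p u)

/-- The mean curvature vector is parallel in the normal bundle: `DH = 0`. -/
def HasParallelMeanCurvature {m : ℕ} (g : RiemMetric n M) (x : M → Euc m) : Prop :=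
  ∀ (p : M) (u : TangentSpace (𝓡 n) p), normalDerivative x (meanCurvatureVector g x) p u = 0

/-- `x` immerses `M` as a minimal submanifold of a hypersphere of `𝔼ᵐ`: it takes its values in the
hypersphere with some centre `a` and radius `r > 0`, and its mean curvature vector in this
hypersphere, whose tangent space at `y` is the orthogonal complement of `y - a`, vanishes. -/
def IsMinimalInHypersphere {m : ℕ} (g : RiemMetric n M) (x : M → Euc m) : Prop :=
  ∃ (a : Euc m) (r : ℝ), 0 < r ∧ (∀ p, x p ∈ Metric.sphere a r) ∧
    ∀ p, meanCurvatureVectorIn g (Submodule.span ℝ {x p - a})ᗮ x p = 0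

end

end LaplaceTransformation

end

/-!
The proof compares `x` with its Laplacian `L = Δx` through their differentials. By Beltrami's
formula `L = -nH`, so `L` is normal to `x`, and `DH = 0` says that `dL` takes its values in the
tangent spaces of `x`. Suppose that `L` is homothetic with factor `c`. Put `y = cx + L` and
`z = cx - L`. Since `⟨dL, dL⟩ = c² ⟨dx, dx⟩` and the shape operator of `L` is symmetric,
`⟨dy(u), dz(v)⟩ = 0` for all `u` and `v`, and each tangent space is the sum of the kernels of `dy`
and `dz` (the two eigenspaces of the shape operator).

The key point is that the second derivatives of `y` and `z` are orthogonal too. The trilinear form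
`⟨D²y(u, v), dz(w)⟩` equals `-⟨dy(v), D²z(u, w)⟩`, hence is totally symmetric, and it vanishes when
an argument lies in either kernel, so it is zero (`inner_secondDeriv_fderiv_eq_zero`).
Differentiating once more, the same argument applies to the 4-linear form `⟨D²y(u, v), D²z(s, w)⟩`
(`inner_secondDeriv_secondDeriv_eq_zero`). This replaces the parallelism of the shape operator and
the Gauss equation. Now `tr D²y + tr D²z = 2c tr D²x` is `-2cL` up to a tangent vector, and `L` is
orthogonal to `dz`, so that `2⟨L, tr D²z⟩ = tr ⟨dz, dz⟩`. It follows that, for a certain tangent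
vector `τ`, `‖tr D²z - dz(τ)‖² = -c tr ⟨dz, dz⟩`, hence `dz = 0` and `dL = c dx`
(`fderiv_eq_smul_of_homothetic`). On the connected manifold `M` this integrates to `L = c (x - a)`.
As `L` is normal, `‖L‖` is constant, so `x` lies in a hypersphere with centre `a`, and its mean
curvature vector, a multiple of `x - a`, has no component tangent to the hypersphere.

Conversely, the position vector of a submanifold of the hypersphere is normal, and minimality forces
`L` to be a multiple of `x - a`; since `⟨x - a, L⟩ = tr ⟨dx, dx⟩ = n`, it is `L = (n / r²) (x - a)`.

The Laplacian is defined at each point through the preferred chart at that point. To differentiate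
it, it is described independently of coordinates as the normal vector that differs from `-tr D²x` by
a tangent vector (`IsLaplacianAt`); this also gives its smoothness.
-/

namespace LaplaceTransformation

/-! ### Second derivatives of vector-valued functions -/

section SecondDerivative

variable {E F : Type*} [NormedAddCommGroup E] [NormedSpace ℝ E]

/-- The second directional derivative `D²f(u, v)` at `z`: the derivative in the direction `u` of the
derivative of `f` in the constant direction `v`. -/
noncomputable def secondDeriv [NormedAddCommGroup F] [NormedSpace ℝ F] (f : E → F) (z u v : E) :
    F :=
  fderiv ℝ (fun w => fderiv ℝ f w v) z u

section Normed

variable [NormedAddCommGroup F] [NormedSpace ℝ F] {f h : E → F} {z : E}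

lemma contDiffAt_fderiv_apply (hf : ContDiffAt ℝ ∞ f z) (v : E) :
    ContDiffAt ℝ ∞ (fun w => fderiv ℝ f w v) z :=
  (hf.fderiv_right (m := ∞) (by simp)).clm_apply contDiffAt_const

lemma contDiffAt_secondDeriv (hf : ContDiffAt ℝ ∞ f z) (u v : E) :
    ContDiffAt ℝ ∞ (fun w => secondDeriv f w u v) z :=
  contDiffAt_fderiv_apply (contDiffAt_fderiv_apply hf v) u

lemma differentiableAt_of_contDiffAt (hf : ContDiffAt ℝ ∞ f z) : DifferentiableAt ℝ f z :=
  hf.differentiableAt (by simp)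

lemma eventually_differentiableAt (hf : ContDiffAt ℝ ∞ f z) :
    ∀ᶠ w in nhds z, DifferentiableAt ℝ f w := by
  filter_upwards [(hf.of_le (m := 1) (by simp)).eventually (by simp)] with w hw
  exact hw.differentiableAt (by simp)

lemma secondDeriv_eq_fderiv_fderiv (hf : ContDiffAt ℝ ∞ f z) (u v : E) :
    secondDeriv f z u v = fderiv ℝ (fderiv ℝ f) z u v := by
  have h : DifferentiableAt ℝ (fderiv ℝ f) z :=
    (hf.fderiv_right (m := ∞) (by simp)).differentiableAt (by simp)
  have := (h.hasFDerivAt.clm_apply (hasFDerivAt_const v z)).fderiv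
  rw [secondDeriv, this]
  simp

lemma secondDeriv_comm (hf : ContDiffAt ℝ ∞ f z) (u v : E) :
    secondDeriv f z u v = secondDeriv f z v u := by
  rw [secondDeriv_eq_fderiv_fderiv hf, secondDeriv_eq_fderiv_fderiv hf]
  exact (hf.isSymmSndFDerivAt (by simpa using ENat.LEInfty.out)) u v

lemma secondDeriv_add_right (hf : ContDiffAt ℝ ∞ f z) (u v v' : E) :
    secondDeriv f z u (v + v') = secondDeriv f z u v + secondDeriv f z u v' := by
  simp only [secondDeriv_eq_fderiv_fderiv hf, map_add]

lemma secondDeriv_add (hf : ContDiffAt ℝ ∞ f z) (hh : ContDiffAt ℝ ∞ h z) (u v : E) :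
    secondDeriv (fun w => f w + h w) z u v = secondDeriv f z u v + secondDeriv h z u v := by
  have e : (fun w => fderiv ℝ (fun w => f w + h w) w v) =ᶠ[nhds z]
      fun w => fderiv ℝ f w v + fderiv ℝ h w v := by
    filter_upwards [eventually_differentiableAt hf, eventually_differentiableAt hh] with w h1 h2
    rw [fderiv_fun_add h1 h2]
    rfl
  rw [secondDeriv, e.fderiv_eq, fderiv_fun_add
    (differentiableAt_of_contDiffAt (contDiffAt_fderiv_apply hf v))
    (differentiableAt_of_contDiffAt (contDiffAt_fderiv_apply hh v))]
  rfl

lemma secondDeriv_const_smul (hf : ContDiffAt ℝ ∞ f z) (r : ℝ) (u v : E) :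
    secondDeriv (fun w => r • f w) z u v = r • secondDeriv f z u v := by
  have e : (fun w => fderiv ℝ (fun w => r • f w) w v) =ᶠ[nhds z] fun w => r • fderiv ℝ f w v := by
    filter_upwards [eventually_differentiableAt hf] with w h1
    rw [fderiv_fun_const_smul h1]
    rfl
  rw [secondDeriv, e.fderiv_eq, fderiv_fun_const_smul
    (differentiableAt_of_contDiffAt (contDiffAt_fderiv_apply hf v))]
  rfl

/-- The second derivative of a composition. The last term is what makes the Hessian of a function
in a chart non-tensorial; it is tangential when `f` is an immersion. -/
lemma secondDeriv_comp {G : Type*} [NormedAddCommGroup G] [NormedSpace ℝ G] {t : E → G} {k : G → F}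
    (hk : ContDiffAt ℝ ∞ k (t z)) (ht : ContDiffAt ℝ ∞ t z) (u v : E) :
    secondDeriv (k ∘ t) z u v = secondDeriv k (t z) (fderiv ℝ t z u) (fderiv ℝ t z v)
      + fderiv ℝ k (t z) (secondDeriv t z u v) := by
  have e : (fun w => fderiv ℝ (k ∘ t) w v) =ᶠ[nhds z]
      fun w => fderiv ℝ k (t w) (fderiv ℝ t w v) := by
    filter_upwards [eventually_differentiableAt ht,
      ht.continuousAt.eventually (eventually_differentiableAt hk)] with w h1 h2
    rw [fderiv_comp _ h2 h1]
    rfl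
  have hk' : DifferentiableAt ℝ (fderiv ℝ k) (t z) :=
    (hk.fderiv_right (m := ∞) (by simp)).differentiableAt (by simp)
  have h1 : HasFDerivAt (fun w => fderiv ℝ k (t w))
      ((fderiv ℝ (fderiv ℝ k) (t z)).comp (fderiv ℝ t z)) z :=
    hk'.hasFDerivAt.comp z (differentiableAt_of_contDiffAt ht).hasFDerivAt
  have h2 := (differentiableAt_of_contDiffAt (contDiffAt_fderiv_apply ht v)).hasFDerivAt
  rw [secondDeriv, e.fderiv_eq, (h1.clm_apply h2).fderiv, secondDeriv_eq_fderiv_fderiv hk]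
  simp [secondDeriv, add_comm]

lemma secondDeriv_congr {f h : E → F} {z : E} (e : f =ᶠ[nhds z] h) (u v : E) :
    secondDeriv f z u v = secondDeriv h z u v := by
  have : (fun w => fderiv ℝ f w v) =ᶠ[nhds z] fun w => fderiv ℝ h w v := by
    filter_upwards [e.fderiv (𝕜 := ℝ)] with w hw
    rw [hw]
  rw [secondDeriv, this.fderiv_eq, secondDeriv]

end Normed

variable [NormedAddCommGroup F] [InnerProductSpace ℝ F]

/-- Differentiation of an identity `⟨f, h⟩ = r` valid on an open set. -/
lemma inner_fderiv_add_inner_fderiv_eq_zero {U : Set E} (hU : IsOpen U) {f h : E → F} {r : ℝ}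
    (e : ∀ z ∈ U, inner ℝ (f z) (h z) = r) {z : E} (hz : z ∈ U)
    (hf : ContDiffAt ℝ ∞ f z) (hh : ContDiffAt ℝ ∞ h z) (u : E) :
    inner ℝ (fderiv ℝ f z u) (h z) + inner ℝ (f z) (fderiv ℝ h z u) = 0 := by
  have e' : (fun z => inner ℝ (f z) (h z)) =ᶠ[nhds z] fun _ => r := by
    filter_upwards [hU.mem_nhds hz] with w hw using e w hw
  have h1 := fderiv_inner_apply ℝ (differentiableAt_of_contDiffAt hf)
    (differentiableAt_of_contDiffAt hh) u
  rw [e'.fderiv_eq] at h1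
  simp at h1
  linarith

/-! ### Maps with orthogonal differentials -/

section Orthogonal

variable {U : Set E} {y z : E → F}

/-- If `y` and `z` have orthogonal differentials whose kernels span, the second derivatives of `y`
are orthogonal to the first derivatives of `z`: the trilinear form `⟨D²y(u, v), dz(w)⟩` is totally
symmetric and vanishes when its last argument is in either kernel. -/
lemma inner_secondDeriv_fderiv_eq_zero (hU : IsOpen U)
    (hy : ∀ p ∈ U, ContDiffAt ℝ ∞ y p) (hz : ∀ p ∈ U, ContDiffAt ℝ ∞ z p)
    (orth : ∀ p ∈ U, ∀ u v, inner ℝ (fderiv ℝ y p u) (fderiv ℝ z p v) = 0)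
    (span : ∀ p ∈ U, ∀ u, ∃ w, fderiv ℝ z p w = 0 ∧ fderiv ℝ y p (u - w) = 0)
    {p : E} (hp : p ∈ U) (u v w : E) :
    inner ℝ (secondDeriv y p u v) (fderiv ℝ z p w) = 0 := by
  have step (u v w : E) : inner ℝ (secondDeriv y p u v) (fderiv ℝ z p w)
      + inner ℝ (fderiv ℝ y p v) (secondDeriv z p u w) = 0 :=
    inner_fderiv_add_inner_fderiv_eq_zero hU (fun q hq => orth q hq v w) hp
      (contDiffAt_fderiv_apply (hy p hp) v) (contDiffAt_fderiv_apply (hz p hp) w) u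
  have sym (u v w : E) : inner ℝ (secondDeriv y p u v) (fderiv ℝ z p w)
      = inner ℝ (secondDeriv y p w v) (fderiv ℝ z p u) := by
    have h1 := step u v w
    have h2 := step w v u
    rw [secondDeriv_comm (hz p hp) w u] at h2
    linarith
  obtain ⟨w', h1, h2⟩ := span p hp w
  have e : fderiv ℝ z p w = fderiv ℝ z p (w - w') := by rw [map_sub, h1, sub_zero]
  rw [e, secondDeriv_comm (hy p hp), sym, secondDeriv_comm (hy p hp)]
  have h3 := step u (w - w') v
  rw [h2, inner_zero_left, add_zero] at h3
  exact h3

/-- Under the same hypotheses the second derivatives of `y` and `z` are orthogonal as well. The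
4-linear form `⟨D²y(u, v), D²z(s, w)⟩ = -⟨D³y(s, u, v), dz(w)⟩` is totally symmetric, hence
vanishes when any of its arguments is in either kernel. -/
lemma inner_secondDeriv_secondDeriv_eq_zero (hU : IsOpen U)
    (hy : ∀ p ∈ U, ContDiffAt ℝ ∞ y p) (hz : ∀ p ∈ U, ContDiffAt ℝ ∞ z p)
    (orth : ∀ p ∈ U, ∀ u v, inner ℝ (fderiv ℝ y p u) (fderiv ℝ z p v) = 0)
    (span : ∀ p ∈ U, ∀ u, ∃ w, fderiv ℝ z p w = 0 ∧ fderiv ℝ y p (u - w) = 0)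
    {p : E} (hp : p ∈ U) (u v s w : E) :
    inner ℝ (secondDeriv y p u v) (secondDeriv z p s w) = 0 := by
  have hyp := hy p hp
  have hzp := hz p hp
  have stepy (u v s w : E) :
      inner ℝ (secondDeriv (fun q => fderiv ℝ y q v) p s u) (fderiv ℝ z p w)
        + inner ℝ (secondDeriv y p u v) (secondDeriv z p s w) = 0 :=
    inner_fderiv_add_inner_fderiv_eq_zero hU
      (fun q hq => inner_secondDeriv_fderiv_eq_zero hU hy hz orth span hq u v w) hp
      (contDiffAt_secondDeriv hyp u v) (contDiffAt_fderiv_apply hzp w) s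
  have orth' : ∀ p ∈ U, ∀ u v, inner ℝ (fderiv ℝ z p u) (fderiv ℝ y p v) = 0 := fun q hq a b => by
    rw [real_inner_comm, orth q hq]
  have span' : ∀ p ∈ U, ∀ u, ∃ w, fderiv ℝ y p w = 0 ∧ fderiv ℝ z p (u - w) = 0 := by
    intro q hq a
    obtain ⟨b, h1, h2⟩ := span q hq a
    exact ⟨a - b, h2, by rw [sub_sub_cancel, h1]⟩
  have stepz (u v s w : E) :
      inner ℝ (secondDeriv (fun q => fderiv ℝ z q v) p s u) (fderiv ℝ y p w)
        + inner ℝ (secondDeriv z p u v) (secondDeriv y p s w) = 0 :=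
    inner_fderiv_add_inner_fderiv_eq_zero hU
      (fun q hq => inner_secondDeriv_fderiv_eq_zero hU hz hy orth' span' hq u v w) hp
      (contDiffAt_secondDeriv hzp u v) (contDiffAt_fderiv_apply hyp w) s
  have sym (u v s w : E) : inner ℝ (secondDeriv y p u v) (secondDeriv z p s w)
      = inner ℝ (secondDeriv y p s v) (secondDeriv z p u w) := by
    have h1 := stepy u v s w
    have h2 := stepy s v u w
    rw [secondDeriv_comm (contDiffAt_fderiv_apply hyp v)] at h2
    linarith
  obtain ⟨w', h1, h2⟩ := span p hp w
  have e : secondDeriv z p s w = secondDeriv z p s w' + secondDeriv z p s (w - w') := by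
    rw [← secondDeriv_add_right hzp, add_sub_cancel]
  have h3 := stepy u v s w'
  rw [h1, inner_zero_right, zero_add] at h3
  have h4 := stepz u s v (w - w')
  rw [h2, inner_zero_right, zero_add, real_inner_comm] at h4
  rw [e, inner_add_right, h3, zero_add, secondDeriv_comm hzp s, sym, secondDeriv_comm hyp _ v, h4]

end Orthogonal

end SecondDerivative

/-! ### Traces with respect to the metric induced by an injective linear map -/

section GramTrace

variable {n m : ℕ}

lemma sum_smul_stdVec (u : Euc n) : ∑ i, u i • stdVec i = u := by
  ext k
  simp [stdVec, Finset.sum_apply, Pi.single_apply]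

lemma map_eq_sum_stdVec {F : Type*} [AddCommGroup F] [Module ℝ F] [TopologicalSpace F]
    (T : Euc n →L[ℝ] F) (u : Euc n) : T u = ∑ i, u i • T (stdVec i) := by
  conv_lhs => rw [← sum_smul_stdVec u]
  simp [map_sum]

/-- The matrix of the scalar product pulled back by `T`, in the standard basis. -/
noncomputable def gramMatrix (T : Euc n →L[ℝ] Euc m) : Matrix (Fin n) (Fin n) ℝ :=
  Matrix.gram ℝ fun i => T (stdVec i)

lemma gramMatrix_apply (T : Euc n →L[ℝ] Euc m) (i j : Fin n) :
    gramMatrix T i j = inner ℝ (T (stdVec i)) (T (stdVec j)) := rfl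

/-- The trace of `B` with respect to the scalar product pulled back by `T`. It is meaningful for
injective `T`. -/
noncomputable def gramTrace {F : Type*} [AddCommGroup F] [Module ℝ F] (T : Euc n →L[ℝ] Euc m)
    (B : Euc n → Euc n → F) : F :=
  ∑ i, ∑ j, (gramMatrix T)⁻¹ i j • B (stdVec i) (stdVec j)

variable {T : Euc n →L[ℝ] Euc m}

lemma gramMatrix_posDef (hT : Function.Injective T) : (gramMatrix T).PosDef := by
  apply Matrix.posDef_gram_of_linearIndependent
  rw [Fintype.linearIndependent_iff]
  intro c hc i
  have h : T (∑ i, c i • stdVec i) = T 0 := by simpa [map_sum] using hc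
  have h' := congrArg (fun u : Euc n => u i) (hT h)
  simpa [stdVec, Pi.single_apply] using h'

lemma isUnit_det_gramMatrix (hT : Function.Injective T) : IsUnit (gramMatrix T).det :=
  (Matrix.isUnit_iff_isUnit_det _).1 (gramMatrix_posDef hT).isUnit

lemma gramMatrix_inv_symm (hT : Function.Injective T) (i j : Fin n) :
    (gramMatrix T)⁻¹ i j = (gramMatrix T)⁻¹ j i := by
  have := (gramMatrix_posDef hT).inv.isHermitian.apply i j
  simpa using this.symm

lemma sum_gramMatrix_inv_mul (hT : Function.Injective T) (i k : Fin n) :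
    ∑ j, (gramMatrix T)⁻¹ i j * inner ℝ (T (stdVec j)) (T (stdVec k)) = if i = k then 1 else 0 := by
  have := congrFun (congrFun (Matrix.nonsing_inv_mul _ (isUnit_det_gramMatrix hT)) i) k
  rwa [Matrix.mul_apply, Matrix.one_apply] at this

section Module

variable {F F' : Type*} [AddCommGroup F] [Module ℝ F] [AddCommGroup F'] [Module ℝ F']

lemma map_gramTrace (φ : F →ₗ[ℝ] F') (B : Euc n → Euc n → F) :
    φ (gramTrace T B) = gramTrace T fun u v => φ (B u v) := by
  simp [gramTrace, map_sum]

lemma gramTrace_add (B C : Euc n → Euc n → F) :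
    gramTrace T (fun u v => B u v + C u v) = gramTrace T B + gramTrace T C := by
  simp [gramTrace, Finset.sum_add_distrib]

lemma gramTrace_smul (r : ℝ) (B : Euc n → Euc n → F) :
    gramTrace T (fun u v => r • B u v) = r • gramTrace T B := by
  simp [gramTrace, Finset.smul_sum, smul_comm r]

lemma gramTrace_congr {B C : Euc n → Euc n → F} (h : ∀ u v, B u v = C u v) :
    gramTrace T B = gramTrace T C := by
  simp [gramTrace, h]

lemma gramTrace_mem {W : Submodule ℝ F} {B : Euc n → Euc n → F} (h : ∀ u v, B u v ∈ W) :
    gramTrace T B ∈ W :=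
  W.sum_mem fun _ _ => W.sum_mem fun _ _ => W.smul_mem _ (h _ _)

end Module

lemma inner_gramTrace {F : Type*} [NormedAddCommGroup F] [InnerProductSpace ℝ F] (w : F)
    (B : Euc n → Euc n → F) :
    inner ℝ w (gramTrace T B) = gramTrace T fun u v => inner ℝ w (B u v) :=
  map_gramTrace (innerₛₗ ℝ w) B

/-- The trace of the scalar product itself is the dimension. -/
lemma gramTrace_inner_self (hT : Function.Injective T) :
    gramTrace T (fun u v => inner ℝ (T u) (T v)) = (n : ℝ) := by
  have h (i : Fin n) : ∑ j, (gramMatrix T)⁻¹ i j * inner ℝ (T (stdVec i)) (T (stdVec j)) = 1 := by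
    simp_rw [real_inner_comm (T (stdVec _)) (T (stdVec i))]
    simpa using sum_gramMatrix_inv_mul hT i i
  simp [gramTrace, h]

lemma gramTrace_inner_nonneg (hT : Function.Injective T) (Z : Euc n →L[ℝ] Euc m) :
    0 ≤ gramTrace T (fun u v => inner ℝ (Z u) (Z v)) ∧
      (gramTrace T (fun u v => inner ℝ (Z u) (Z v)) = 0 → Z = 0) := by
  -- the trace is the sum over the rows `r` of the matrix of `Z` of the values `r G⁻¹ rᵀ`
  let row (k : Fin m) (i : Fin n) : ℝ := Z (stdVec i) k
  have hpos := (gramMatrix_posDef hT).inv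
  have e : gramTrace T (fun u v => inner ℝ (Z u) (Z v))
      = ∑ k, star (row k) ⬝ᵥ ((gramMatrix T)⁻¹).mulVec (row k) := by
    simp only [gramTrace, PiLp.inner_apply, dotProduct, Matrix.mulVec, Finset.mul_sum,
      smul_eq_mul]
    rw [Finset.sum_comm' (t' := Finset.univ) (s' := fun _ => Finset.univ) (by simp)]
    conv_rhs => rw [Finset.sum_comm]
    conv_lhs => rw [Finset.sum_comm]
    refine Finset.sum_congr rfl fun i _ => ?_
    conv_rhs => rw [Finset.sum_comm]
    refine Finset.sum_congr rfl fun j _ => Finset.sum_congr rfl fun k _ => ?_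
    simp [row]
    ring
  have nn (k : Fin m) : 0 ≤ star (row k) ⬝ᵥ ((gramMatrix T)⁻¹).mulVec (row k) :=
    hpos.posSemidef.dotProduct_mulVec_nonneg _
  rw [e]
  refine ⟨Finset.sum_nonneg fun k _ => nn k, fun h0 => ?_⟩
  rw [Finset.sum_eq_zero_iff_of_nonneg fun k _ => nn k] at h0
  have hrow (k : Fin m) : row k = 0 := by
    by_contra hk
    exact (hpos.dotProduct_mulVec_pos hk).ne' (h0 k (Finset.mem_univ k))
  ext u k
  rw [map_eq_sum_stdVec Z u]
  simp only [PiLp.zero_apply, WithLp.ofLp_sum, Finset.sum_apply, PiLp.smul_apply,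
    zero_apply]
  refine Finset.sum_eq_zero fun i _ => ?_
  have : Z (stdVec i) k = 0 := congrFun (hrow k) i
  simp [this]

/-- The coordinates of a vector in the range of `T`, in terms of its scalar products with the basis
of this range. -/
lemma eq_sum_of_mem_range (hT : Function.Injective T) {w : Euc m} (hw : ∃ u, w = T u) :
    w = ∑ k, (∑ l, (gramMatrix T)⁻¹ k l * inner ℝ (T (stdVec l)) w) • T (stdVec k) := by
  obtain ⟨u, rfl⟩ := hw
  conv_lhs => rw [map_eq_sum_stdVec T u]
  refine Finset.sum_congr rfl fun k _ => ?_
  congr 1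
  simp_rw [map_eq_sum_stdVec T u, inner_sum, inner_smul_right, Finset.mul_sum]
  rw [Finset.sum_comm]
  have h (i : Fin n) : ∑ l, (gramMatrix T)⁻¹ k l * (u i * inner ℝ (T (stdVec l)) (T (stdVec i)))
      = u i * if k = i then 1 else 0 := by
    rw [← sum_gramMatrix_inv_mul hT, Finset.mul_sum]
    exact Finset.sum_congr rfl fun l _ => by ring
  simp [h]

/-- The trace does not depend on the basis used to compute it. -/
lemma gramTrace_comp {F : Type*} [NormedAddCommGroup F] [NormedSpace ℝ F]
    (hT : Function.Injective T) {A : Euc n →L[ℝ] Euc n}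
    (hA : Function.Injective A) (B : Euc n →L[ℝ] Euc n →L[ℝ] F) :
    gramTrace (T.comp A) (fun u v => B (A u) (A v)) = gramTrace T fun u v => B u v := by
  let a : Matrix (Fin n) (Fin n) ℝ := Matrix.of fun k i => A (stdVec i) k
  have hTA (i : Fin n) : T (A (stdVec i)) = ∑ k, a k i • T (stdVec k) :=
    map_eq_sum_stdVec T (A (stdVec i))
  have hG : gramMatrix (T.comp A) = a.transpose * gramMatrix T * a := by
    ext i j
    simp only [gramMatrix_apply, ContinuousLinearMap.comp_apply, hTA, sum_inner, inner_sum,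
      inner_smul_left, inner_smul_right, Matrix.mul_apply, Matrix.transpose_apply,
      Finset.sum_mul, Finset.mul_sum]
    refine Finset.sum_congr rfl fun k _ => Finset.sum_congr rfl fun l _ => ?_
    simp only [conj_trivial]
    ring
  have hdet : IsUnit (gramMatrix (T.comp A)).det := isUnit_det_gramMatrix (hT.comp hA)
  have ha : IsUnit a.det := by
    rw [hG, Matrix.det_mul] at hdet
    exact isUnit_of_mul_isUnit_right hdet
  have hat : IsUnit a.transpose.det := by rwa [Matrix.det_transpose]
  have key : a * (gramMatrix (T.comp A))⁻¹ * a.transpose = (gramMatrix T)⁻¹ := by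
    rw [hG, Matrix.mul_inv_rev, Matrix.mul_inv_rev, ← Matrix.mul_assoc, Matrix.mul_nonsing_inv _ ha,
      Matrix.one_mul, Matrix.mul_assoc, Matrix.nonsing_inv_mul _ hat, Matrix.mul_one]
  have hB (i j : Fin n) : B (A (stdVec i)) (A (stdVec j))
      = ∑ k, ∑ l, (a k i * a l j) • B (stdVec k) (stdVec l) := by
    rw [map_eq_sum_stdVec B (A (stdVec i))]
    simp only [sum_apply, smul_apply]
    refine Finset.sum_congr rfl fun k _ => ?_
    rw [map_eq_sum_stdVec (B (stdVec k)) (A (stdVec j)), Finset.smul_sum]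
    exact Finset.sum_congr rfl fun l _ => smul_smul _ _ _
  have hk (k l : Fin n) : (gramMatrix T)⁻¹ k l
      = ∑ i, ∑ j, (gramMatrix (T.comp A))⁻¹ i j * (a k i * a l j) := by
    rw [← key]
    simp only [Matrix.mul_apply, Matrix.transpose_apply, Finset.sum_mul]
    rw [Finset.sum_comm]
    exact Finset.sum_congr rfl fun i _ => Finset.sum_congr rfl fun j _ => by ring
  simp only [gramTrace, hB, hk, Finset.smul_sum, Finset.sum_smul, smul_smul]
  -- both sides are sums over `i, j, k, l`
  calc _ = ∑ i, ∑ k, ∑ j, ∑ l, ((gramMatrix (T.comp A))⁻¹ i j * (a k i * a l j)) •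
          B (stdVec k) (stdVec l) := Finset.sum_congr rfl fun i _ => Finset.sum_comm
    _ = ∑ k, ∑ i, ∑ j, ∑ l, ((gramMatrix (T.comp A))⁻¹ i j * (a k i * a l j)) •
          B (stdVec k) (stdVec l) := Finset.sum_comm
    _ = ∑ k, ∑ i, ∑ l, ∑ j, ((gramMatrix (T.comp A))⁻¹ i j * (a k i * a l j)) •
          B (stdVec k) (stdVec l) :=
        Finset.sum_congr rfl fun k _ => Finset.sum_congr rfl fun i _ => Finset.sum_comm
    _ = _ := Finset.sum_congr rfl fun k _ => Finset.sum_comm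

end GramTrace

/-! ### Homothetic normal fields on an open set of Euclidean space -/

section Core

variable {n m : ℕ} {U : Set (Euc n)} {X Λ : Euc n → Euc m} {c : ℝ}

/-- The local form of the result. Here `X` is an immersion and `Λ` is its Laplacian, characterized
by being normal and by differing from `-tr D²X` by a tangent vector. If `Λ` is parallel in the
normal bundle and homothetic with factor `c`, then `dΛ = c dX`.

With `y = cX + Λ` and `z = cX - Λ` the claim is `dz = 0`. The differentials of `y` and `z` are
orthogonal, and so are their second derivatives; comparing the traces of `D²y` and `D²z` with
`Λ` shows that the trace of `⟨dz, dz⟩` is at most zero. -/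
theorem fderiv_eq_smul_of_homothetic (hU : IsOpen U) (hc : 0 < c)
    (hX : ∀ p ∈ U, ContDiffAt ℝ ∞ X p) (hΛ : ∀ p ∈ U, ContDiffAt ℝ ∞ Λ p)
    (inj : ∀ p ∈ U, Function.Injective (fderiv ℝ X p))
    (normal : ∀ p ∈ U, ∀ v, inner ℝ (Λ p) (fderiv ℝ X p v) = 0)
    (parallel : ∀ p ∈ U, ∀ u, ∃ w, fderiv ℝ Λ p u = fderiv ℝ X p w)
    (homothetic : ∀ p ∈ U, ∀ u v, inner ℝ (fderiv ℝ Λ p u) (fderiv ℝ Λ p v)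
      = c ^ 2 * inner ℝ (fderiv ℝ X p u) (fderiv ℝ X p v))
    (trace : ∀ p ∈ U, ∃ w, Λ p + gramTrace (fderiv ℝ X p) (secondDeriv X p) = fderiv ℝ X p w)
    {p : Euc n} (hp : p ∈ U) : fderiv ℝ Λ p = c • fderiv ℝ X p := by
  let y : Euc n → Euc m := fun q => c • X q + Λ q
  let z : Euc n → Euc m := fun q => c • X q + (-1 : ℝ) • Λ q
  have hcX (q) (hq : q ∈ U) : ContDiffAt ℝ ∞ (fun q => c • X q) q := (hX q hq).const_smul c
  have hnΛ (q) (hq : q ∈ U) : ContDiffAt ℝ ∞ (fun q => (-1 : ℝ) • Λ q) q := (hΛ q hq).const_smul _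
  have hy (q) (hq : q ∈ U) : ContDiffAt ℝ ∞ y q := (hcX q hq).add (hΛ q hq)
  have hz (q) (hq : q ∈ U) : ContDiffAt ℝ ∞ z q := (hcX q hq).add (hnΛ q hq)
  have dy (q) (hq : q ∈ U) (u : Euc n) : fderiv ℝ y q u = c • fderiv ℝ X q u + fderiv ℝ Λ q u := by
    have h1 := differentiableAt_of_contDiffAt (hX q hq)
    have h2 := differentiableAt_of_contDiffAt (hΛ q hq)
    rw [show fderiv ℝ y q = c • fderiv ℝ X q + fderiv ℝ Λ q from
      ((h1.hasFDerivAt.const_smul c).add h2.hasFDerivAt).fderiv]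
    rfl
  have dz (q) (hq : q ∈ U) (u : Euc n) : fderiv ℝ z q u = c • fderiv ℝ X q u - fderiv ℝ Λ q u := by
    have h1 := differentiableAt_of_contDiffAt (hX q hq)
    have h2 := differentiableAt_of_contDiffAt (hΛ q hq)
    rw [show fderiv ℝ z q = c • fderiv ℝ X q + (-1 : ℝ) • fderiv ℝ Λ q from
      ((h1.hasFDerivAt.const_smul c).add (h2.hasFDerivAt.const_smul (-1 : ℝ))).fderiv]
    simp [sub_eq_add_neg]
  -- the shape operator of `Λ` is symmetric
  have shape (q) (hq : q ∈ U) (u v : Euc n) :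
      inner ℝ (fderiv ℝ Λ q u) (fderiv ℝ X q v) = inner ℝ (fderiv ℝ Λ q v) (fderiv ℝ X q u) := by
    have h (u v : Euc n) : inner ℝ (fderiv ℝ Λ q u) (fderiv ℝ X q v)
        + inner ℝ (Λ q) (secondDeriv X q u v) = 0 :=
      inner_fderiv_add_inner_fderiv_eq_zero hU (fun r hr => normal r hr v) hq
        (hΛ q hq) (contDiffAt_fderiv_apply (hX q hq) v) u
    have h1 := h u v
    have h2 := h v u
    rw [secondDeriv_comm (hX q hq)] at h2
    linarith
  have orth : ∀ q ∈ U, ∀ u v, inner ℝ (fderiv ℝ y q u) (fderiv ℝ z q v) = 0 := by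
    intro q hq u v
    rw [dy q hq, dz q hq]
    simp only [inner_add_left, inner_sub_right, real_inner_smul_left, real_inner_smul_right,
      homothetic q hq, real_inner_comm (fderiv ℝ Λ q v) (fderiv ℝ X q u), shape q hq u v]
    ring
  have span : ∀ q ∈ U, ∀ u, ∃ w, fderiv ℝ z q w = 0 ∧ fderiv ℝ y q (u - w) = 0 := by
    intro q hq u
    obtain ⟨w, hw⟩ := parallel q hq u
    -- `v` is the tangent vector with `dy(u) = 2c dX(v) = dy(v) + dz(v)`
    let v : Euc n := (2 * c)⁻¹ • (c • u + w)
    have e : fderiv ℝ y q (u - v) = fderiv ℝ z q v := by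
      have h1 : fderiv ℝ y q v + fderiv ℝ z q v = (2 * c) • fderiv ℝ X q v := by
        rw [dy q hq, dz q hq]; module
      have h2 : (2 * c) • fderiv ℝ X q v = c • fderiv ℝ X q u + fderiv ℝ X q w := by
        rw [← map_smul, smul_smul, mul_inv_cancel₀ (by positivity), one_smul, map_add, map_smul]
      rw [map_sub, dy q hq u, hw, ← h2, ← h1]
      abel
    have h0 : fderiv ℝ z q v = 0 := by
      have := orth q hq (u - v) v
      rwa [e, inner_self_eq_zero] at this
    exact ⟨v, h0, e.trans h0⟩
  have hyz (u v w) := inner_secondDeriv_fderiv_eq_zero hU hy hz orth span hp u v w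
  have hzy (u v w : Euc n) : inner ℝ (secondDeriv z p u v) (fderiv ℝ y p w) = 0 := by
    refine inner_secondDeriv_fderiv_eq_zero hU hz hy
      (fun q hq u v => by rw [real_inner_comm, orth q hq]) (fun q hq u => ?_) hp u v w
    obtain ⟨b, h1, h2⟩ := span q hq u
    exact ⟨u - b, h2, by rw [sub_sub_cancel, h1]⟩
  have hyz2 (u v s w) := inner_secondDeriv_secondDeriv_eq_zero hU hy hz orth span hp u v s w
  have hT := inj p hp
  set T := fderiv ℝ X p with hTdef
  obtain ⟨τ, hτ⟩ := trace p hp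
  let a := gramTrace T (secondDeriv y p)
  let b := gramTrace T (secondDeriv z p)
  have hab : a + b = fderiv ℝ y p τ + fderiv ℝ z p τ - (2 * c) • Λ p := by
    have h1 : a + b = (2 * c) • gramTrace T (secondDeriv X p) := by
      rw [← gramTrace_smul, ← gramTrace_add]
      refine gramTrace_congr fun u v => ?_
      rw [secondDeriv_add (hcX p hp) (hΛ p hp), secondDeriv_add (hcX p hp) (hnΛ p hp),
        secondDeriv_const_smul (hX p hp), secondDeriv_const_smul (hΛ p hp)]
      module
    rw [h1, eq_sub_of_add_eq' hτ, dy p hp, dz p hp]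
    module
  have inner_dz_a (w : Euc n) : inner ℝ (fderiv ℝ z p w) a = 0 := by
    rw [inner_gramTrace, gramTrace_congr (C := fun _ _ => (0 : ℝ)) fun u v => by
      rw [real_inner_comm, hyz]]
    simp [gramTrace]
  have inner_dy_b (w : Euc n) : inner ℝ (fderiv ℝ y p w) b = 0 := by
    rw [inner_gramTrace, gramTrace_congr (C := fun _ _ => (0 : ℝ)) fun u v => by
      rw [real_inner_comm, hzy]]
    simp [gramTrace]
  have inner_a_b : inner ℝ a b = 0 := by
    rw [inner_gramTrace, gramTrace_congr (C := fun _ _ => (0 : ℝ)) fun u v => by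
      rw [real_inner_comm, inner_gramTrace, gramTrace_congr (C := fun _ _ => (0 : ℝ)) fun s w => by
        rw [real_inner_comm, hyz2]]
      simp [gramTrace]]
    simp [gramTrace]
  have normal_dz (q) (hq : q ∈ U) (v : Euc n) : inner ℝ (Λ q) (fderiv ℝ z q v) = 0 := by
    obtain ⟨w, hw⟩ := parallel q hq v
    rw [dz q hq, hw, inner_sub_right, real_inner_smul_right, normal q hq, normal q hq]
    ring
  let S := gramTrace T fun u v => inner ℝ (fderiv ℝ z p u) (fderiv ℝ z p v)
  have inner_Λ_b : inner ℝ (Λ p) b = (1 / 2 : ℝ) * S := by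
    rw [inner_gramTrace, ← smul_eq_mul, ← gramTrace_smul]
    refine gramTrace_congr fun u v => ?_
    have h := inner_fderiv_add_inner_fderiv_eq_zero hU (fun r hr => normal_dz r hr v) hp
      (hΛ p hp) (contDiffAt_fderiv_apply (hz p hp) v) u
    have e : fderiv ℝ Λ p u = (1 / 2 : ℝ) • (fderiv ℝ y p u - fderiv ℝ z p u) := by
      rw [dy p hp, dz p hp]; module
    rw [e, real_inner_smul_left, inner_sub_left, orth p hp] at h
    change inner ℝ (Λ p) (fderiv ℝ (fun w => fderiv ℝ z w v) p u) = _
    rw [smul_eq_mul]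
    linarith
  obtain ⟨hS, hS0⟩ := gramTrace_inner_nonneg hT (fderiv ℝ z p)
  have hbb : inner ℝ b b = inner ℝ (fderiv ℝ z p τ) b - c * S := by
    have h := congrArg (fun w => inner ℝ w b) hab
    simp only [inner_add_left, inner_sub_left, real_inner_smul_left, inner_a_b, inner_dy_b,
      inner_Λ_b] at h
    linarith
  have hzb : inner ℝ (fderiv ℝ z p τ) b = inner ℝ (fderiv ℝ z p τ) (fderiv ℝ z p τ) := by
    have h := congrArg (fun w => inner ℝ (fderiv ℝ z p τ) w) hab
    simp only [inner_add_right, inner_sub_right, real_inner_smul_right, inner_dz_a] at h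
    rw [real_inner_comm (fderiv ℝ y p τ), orth p hp, real_inner_comm (Λ p), normal_dz p hp] at h
    linarith
  have hsq : 0 ≤ inner ℝ (b - fderiv ℝ z p τ) (b - fderiv ℝ z p τ) := real_inner_self_nonneg
  rw [inner_sub_left, inner_sub_right, inner_sub_right, real_inner_comm (fderiv ℝ z p τ) b] at hsq
  have hz0 := hS0 (le_antisymm (by change S ≤ 0; nlinarith) hS)
  ext1 u
  have h := dz p hp u
  rw [hz0] at h
  exact (sub_eq_zero.1 h.symm).symm

end Core

/-! ### Functions on a manifold in a preferred chart -/

section Chart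

variable {n : ℕ} {M : Type*} [TopologicalSpace M] [ChartedSpace (Euc n) M]

lemma mvfderiv_eq_fderiv_inChart {F : Type*} [NormedAddCommGroup F] [NormedSpace ℝ F] {f : M → F}
    {p : M} (hf : MDifferentiableAt (𝓡 n) 𝓘(ℝ, F) f p) (u : Euc n) :
    mvfderiv (𝓡 n) f p u = fderiv ℝ (inChart p f) (extChartAt (𝓡 n) p p) u := by
  have h : mfderiv (𝓡 n) 𝓘(ℝ, F) f p = fderiv ℝ (inChart p f) (extChartAt (𝓡 n) p p) := by
    rw [hf.mfderiv, modelWithCornersSelf_coe, Set.range_id, fderivWithin_univ]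
    rfl
  exact DFunLike.congr_fun h u

variable [IsManifold (𝓡 n) ∞ M]

lemma contMDiffAt_extChartAt_symm {p : M} {z : Euc n} (hz : z ∈ (extChartAt (𝓡 n) p).target) :
    ContMDiffAt 𝓘(ℝ, Euc n) (𝓡 n) ∞ (extChartAt (𝓡 n) p).symm z :=
  (contMDiffOn_extChartAt_symm p).contMDiffAt ((isOpen_extChartAt_target p).mem_nhds hz)

lemma mfderiv_extChartAt_symm_isInvertible {p : M} {z : Euc n}
    (hz : z ∈ (extChartAt (𝓡 n) p).target) :
    (mfderiv 𝓘(ℝ, Euc n) (𝓡 n) (extChartAt (𝓡 n) p).symm z).IsInvertible := by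
  have h := isInvertible_mfderivWithin_extChartAt_symm (I := 𝓡 n) hz
  rwa [modelWithCornersSelf_coe, Set.range_id, mfderivWithin_univ] at h

section

variable {F : Type*} [NormedAddCommGroup F] [NormedSpace ℝ F] {f : M → F} {p : M} {z : Euc n}

lemma contDiffAt_inChart (hz : z ∈ (extChartAt (𝓡 n) p).target)
    (hf : ContMDiffAt (𝓡 n) 𝓘(ℝ, F) ∞ f ((extChartAt (𝓡 n) p).symm z)) :
    ContDiffAt ℝ ∞ (inChart p f) z :=
  contMDiffAt_iff_contDiffAt.1 (hf.comp z (contMDiffAt_extChartAt_symm hz))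

lemma fderiv_inChart (hz : z ∈ (extChartAt (𝓡 n) p).target)
    (hf : MDifferentiableAt (𝓡 n) 𝓘(ℝ, F) f ((extChartAt (𝓡 n) p).symm z)) (u : Euc n) :
    fderiv ℝ (inChart p f) z u = mvfderiv (𝓡 n) f ((extChartAt (𝓡 n) p).symm z)
      (mfderiv 𝓘(ℝ, Euc n) (𝓡 n) (extChartAt (𝓡 n) p).symm z u) := by
  have h := mfderiv_comp z hf ((contMDiffAt_extChartAt_symm hz).mdifferentiableAt (by simp))
  rw [mfderiv_eq_fderiv] at h
  change fderiv ℝ (f ∘ (extChartAt (𝓡 n) p).symm) z u = _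
  rw [h]
  rfl

end

end Chart

/-! ### The Laplacian of an immersion of a Euclidean domain -/

section LaplacianAt

variable {n m : ℕ} {X : Euc n → Euc m} {z : Euc n} {w : Euc m}

/-- `w` is the value at `z` of the Laplacian of the immersion `X` with respect to the metric it
induces. The Laplacian is characterized as the normal vector that differs from the trace of `-D²X`
by a tangent vector; in this form it is visibly independent of the coordinates. -/
structure IsLaplacianAt (X : Euc n → Euc m) (z : Euc n) (w : Euc m) : Prop where
  inner_eq_zero : ∀ v, inner ℝ w (fderiv ℝ X z v) = 0
  exists_tangent : ∃ u, w + gramTrace (fderiv ℝ X z) (secondDeriv X z) = fderiv ℝ X z u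

/-- The Laplacian in terms of the inverse of the metric: the normal part of `-tr D²X`. -/
lemma IsLaplacianAt.eq_sum (h : IsLaplacianAt X z w) (hX : Function.Injective (fderiv ℝ X z)) :
    w = -gramTrace (fderiv ℝ X z) (secondDeriv X z)
      + ∑ k, (∑ l, (gramMatrix (fderiv ℝ X z))⁻¹ k l * inner ℝ (fderiv ℝ X z (stdVec l))
        (gramTrace (fderiv ℝ X z) (secondDeriv X z))) • fderiv ℝ X z (stdVec k) := by
  have e := eq_sum_of_mem_range hX h.exists_tangent
  have h0 (l : Fin n) : inner ℝ (fderiv ℝ X z (stdVec l)) w = 0 := by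
    rw [real_inner_comm, h.inner_eq_zero]
  simp only [inner_add_right, h0, zero_add] at e
  rw [eq_neg_add_iff_add_eq, add_comm, e]

/-- Invariance of the Laplacian under a change of coordinates. -/
lemma IsLaplacianAt.comp {t : Euc n → Euc n} (h : IsLaplacianAt X (t z) w)
    (hX : ContDiffAt ℝ ∞ X (t z)) (ht : ContDiffAt ℝ ∞ t z)
    (inj : Function.Injective (fderiv ℝ (X ∘ t) z)) : IsLaplacianAt (X ∘ t) z w := by
  have hd : fderiv ℝ (X ∘ t) z = (fderiv ℝ X (t z)).comp (fderiv ℝ t z) :=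
    fderiv_comp _ (differentiableAt_of_contDiffAt hX) (differentiableAt_of_contDiffAt ht)
  have hA : Function.Injective (fderiv ℝ t z) := by
    rw [hd] at inj
    exact Function.Injective.of_comp inj
  have hAs : Function.Surjective (fderiv ℝ t z) :=
    (LinearMap.injective_iff_surjective (f := (fderiv ℝ t z).toLinearMap)).1 hA
  have hT : Function.Injective (fderiv ℝ X (t z)) := by
    intro a b hab
    obtain ⟨a, rfl⟩ := hAs a
    obtain ⟨b, rfl⟩ := hAs b
    rw [hd] at inj
    exact congrArg _ (inj hab)
  refine ⟨fun v => by rw [hd]; exact h.inner_eq_zero _, ?_⟩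
  obtain ⟨u, hu⟩ := h.exists_tangent
  have e1 : gramTrace (fderiv ℝ (X ∘ t) z) (secondDeriv (X ∘ t) z)
      = gramTrace (fderiv ℝ X (t z)) (secondDeriv X (t z))
        + gramTrace ((fderiv ℝ X (t z)).comp (fderiv ℝ t z))
          (fun u v => fderiv ℝ X (t z) (secondDeriv t z u v)) := by
    rw [hd, gramTrace_congr (secondDeriv_comp hX ht), gramTrace_add]
    congr 1
    rw [gramTrace_congr (secondDeriv_eq_fderiv_fderiv hX),
      ← gramTrace_comp hT hA (fderiv ℝ (fderiv ℝ X) (t z))]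
    exact gramTrace_congr fun u v => secondDeriv_eq_fderiv_fderiv hX _ _
  obtain ⟨u', hu'⟩ : gramTrace ((fderiv ℝ X (t z)).comp (fderiv ℝ t z))
      (fun u v => fderiv ℝ X (t z) (secondDeriv t z u v))
      ∈ LinearMap.range (fderiv ℝ X (t z)).toLinearMap :=
    gramTrace_mem fun u v => ⟨_, rfl⟩
  obtain ⟨s, hs⟩ := hAs (u + u')
  refine ⟨s, ?_⟩
  rw [e1, ← add_assoc, hu, ← hu', hd, ContinuousLinearMap.comp_apply, hs, map_add]
  rfl

/-- The entries of the inverse of a smooth matrix function are smooth, by Cramer's rule. -/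
lemma contDiffAt_matrix_inv {k : ℕ} {G : Euc n → Matrix (Fin k) (Fin k) ℝ}
    (hG : ∀ i j, ContDiffAt ℝ ∞ (fun q => G q i j) z) (hdet : IsUnit (G z).det) (i j : Fin k) :
    ContDiffAt ℝ ∞ (fun q => (G q)⁻¹ i j) z := by
  have hd {H : Euc n → Matrix (Fin k) (Fin k) ℝ}
      (hH : ∀ i j, ContDiffAt ℝ ∞ (fun q => H q i j) z) :
      ContDiffAt ℝ ∞ (fun q => (H q).det) z := by
    simp only [Matrix.det_apply]
    exact ContDiffAt.sum fun σ _ => (contDiffAt_prod fun i _ => hH _ _).const_smul _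
  have e (q : Euc n) : (G q)⁻¹ i j = ((G q).det)⁻¹ * ((G q).updateRow j (Pi.single i 1)).det := by
    rw [Matrix.inv_def, Matrix.smul_apply, Ring.inverse_eq_inv', Matrix.adjugate_apply, smul_eq_mul]
  simp only [e]
  refine ((hd hG).inv hdet.ne_zero).mul (hd fun a b => ?_)
  by_cases h : a = j
  · subst h
    simpa using contDiffAt_const
  · simpa [Matrix.updateRow_ne h] using hG a b

/-- The Laplacian of an immersion is smooth, as it is given by the formula
`IsLaplacianAt.eq_sum` in the derivatives of the immersion. -/
lemma contDiffAt_of_isLaplacianAt {Λ : Euc n → Euc m} (hX : ContDiffAt ℝ ∞ X z)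
    (inj : ∀ᶠ q in nhds z, Function.Injective (fderiv ℝ X q))
    (hΛ : ∀ᶠ q in nhds z, IsLaplacianAt X q (Λ q)) : ContDiffAt ℝ ∞ Λ z := by
  have hd (v : Euc n) := contDiffAt_fderiv_apply hX v
  have hG (i j : Fin n) : ContDiffAt ℝ ∞ (fun q => (gramMatrix (fderiv ℝ X q))⁻¹ i j) z :=
    contDiffAt_matrix_inv (fun i j => (hd _).inner ℝ (hd _))
      (isUnit_det_gramMatrix inj.self_of_nhds) i j
  have htr : ContDiffAt ℝ ∞ (fun q => gramTrace (fderiv ℝ X q) (secondDeriv X q)) z :=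
    ContDiffAt.sum fun i _ => ContDiffAt.sum fun j _ =>
      (hG i j).smul (contDiffAt_secondDeriv hX _ _)
  have h : ContDiffAt ℝ ∞ (fun q => -gramTrace (fderiv ℝ X q) (secondDeriv X q)
      + ∑ k, (∑ l, (gramMatrix (fderiv ℝ X q))⁻¹ k l * inner ℝ (fderiv ℝ X q (stdVec l))
        (gramTrace (fderiv ℝ X q) (secondDeriv X q))) • fderiv ℝ X q (stdVec k)) z :=
    htr.neg.add (ContDiffAt.sum fun k _ =>
      (ContDiffAt.sum fun l _ => (hG k l).mul ((hd _).inner ℝ htr)).smul (hd _))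
  refine h.congr_of_eventuallyEq ?_
  filter_upwards [inj, hΛ] with q h1 h2 using h2.eq_sum h1

end LaplacianAt

/-! ### Isometric immersions in a preferred chart -/

section Immersion

variable {n m : ℕ} {M : Type*} [TopologicalSpace M] [ChartedSpace (Euc n) M]
  [IsManifold (𝓡 n) ∞ M] {g : RiemMetric n M} {x : M → Euc m}

namespace IsIsometricImmersion

lemma mdifferentiableAt (hx : IsIsometricImmersion g x) (p : M) :
    MDifferentiableAt (𝓡 n) 𝓘(ℝ, Euc m) x p :=
  (hx.1 p).mdifferentiableAt (by simp)

/-- An isometric immersion is an immersion, since the metric is positive definite. -/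
lemma mvfderiv_injective (hx : IsIsometricImmersion g x) (p : M) :
    Function.Injective (mvfderiv (𝓡 n) x p) := by
  rw [injective_iff_map_eq_zero]
  intro u hu
  by_contra h
  have h1 := g.pos p u h
  rw [← hx.2 p u u, hu, inner_zero_left] at h1
  exact lt_irrefl _ h1

lemma contDiffAt_inChart (hx : IsIsometricImmersion g x) {p : M} {z : Euc n}
    (hz : z ∈ (extChartAt (𝓡 n) p).target) : ContDiffAt ℝ ∞ (inChart p x) z :=
  LaplaceTransformation.contDiffAt_inChart hz (hx.1 _)

lemma fderiv_inChart_injective (hx : IsIsometricImmersion g x) {p : M} {z : Euc n}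
    (hz : z ∈ (extChartAt (𝓡 n) p).target) : Function.Injective (fderiv ℝ (inChart p x) z) := by
  intro u v huv
  rw [fderiv_inChart hz (hx.mdifferentiableAt _), fderiv_inChart hz (hx.mdifferentiableAt _)] at huv
  exact (mfderiv_extChartAt_symm_isInvertible hz).bijective.1 (hx.mvfderiv_injective _ huv)

lemma gram_eq (hx : IsIsometricImmersion g x) (p : M) :
    gram g p = gramMatrix (fderiv ℝ (inChart p x) (extChartAt (𝓡 n) p p)) := by
  ext i j
  rw [gramMatrix_apply, ← mvfderiv_eq_fderiv_inChart (hx.mdifferentiableAt p),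
    ← mvfderiv_eq_fderiv_inChart (hx.mdifferentiableAt p)]
  exact (hx.2 p _ _).symm

lemma metricTrace_eq {F : Type*} [AddCommGroup F] [Module ℝ F] (hx : IsIsometricImmersion g x)
    (p : M) (B : Euc n → Euc n → F) : metricTrace g p B
      = gramTrace (fderiv ℝ (inChart p x) (extChartAt (𝓡 n) p p)) B := by
  rw [gramTrace, ← hx.gram_eq]
  rfl

lemma metricCoeff_eq (hx : IsIsometricImmersion g x) {p : M} {z : Euc n}
    (hz : z ∈ (extChartAt (𝓡 n) p).target) (i j : Fin n) : metricCoeff g p i j z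
      = inner ℝ (fderiv ℝ (inChart p x) z (stdVec i)) (fderiv ℝ (inChart p x) z (stdVec j)) := by
  rw [fderiv_inChart hz (hx.mdifferentiableAt _), fderiv_inChart hz (hx.mdifferentiableAt _), hx.2]
  rfl

lemma partialD_metricCoeff (hx : IsIsometricImmersion g x) (p : M) (k i j : Fin n) :
    partialD k (metricCoeff g p i j) (extChartAt (𝓡 n) p p)
      = inner ℝ (secondDeriv (inChart p x) (extChartAt (𝓡 n) p p) (stdVec k) (stdVec i))
          (fderiv ℝ (inChart p x) (extChartAt (𝓡 n) p p) (stdVec j))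
        + inner ℝ (secondDeriv (inChart p x) (extChartAt (𝓡 n) p p) (stdVec k) (stdVec j))
          (fderiv ℝ (inChart p x) (extChartAt (𝓡 n) p p) (stdVec i)) := by
  have hz := mem_extChartAt_target (I := 𝓡 n) p
  have e : metricCoeff g p i j =ᶠ[nhds (extChartAt (𝓡 n) p p)] fun z =>
      inner ℝ (fderiv ℝ (inChart p x) z (stdVec i)) (fderiv ℝ (inChart p x) z (stdVec j)) := by
    filter_upwards [(isOpen_extChartAt_target p).mem_nhds hz] with z hz
    exact hx.metricCoeff_eq hz i j
  have hX := hx.contDiffAt_inChart hz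
  rw [partialD, e.fderiv_eq, fderiv_inner_apply ℝ
    (differentiableAt_of_contDiffAt (contDiffAt_fderiv_apply hX _))
    (differentiableAt_of_contDiffAt (contDiffAt_fderiv_apply hX _)), add_comm]
  congr 1
  exact real_inner_comm _ _

/-- Gauss' formula: the Hessian of an isometric immersion is normal. -/
lemma inner_hessian_eq_zero (hx : IsIsometricImmersion g x) (p : M) (i j : Fin n) (v : Euc n) :
    inner ℝ (hessian g x p i j) (fderiv ℝ (inChart p x) (extChartAt (𝓡 n) p p) v) = 0 := by
  have hz := mem_extChartAt_target (I := 𝓡 n) p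
  have hX := hx.contDiffAt_inChart hz
  have hT := hx.fderiv_inChart_injective hz
  set z := extChartAt (𝓡 n) p p
  set X : Euc n → Euc m := inChart p x
  set T := fderiv ℝ X z with hTd
  have hΓ (k : Fin n) : christoffel g p k i j = ∑ l, (gramMatrix T)⁻¹ k l *
      inner ℝ (T (stdVec l)) (secondDeriv X z (stdVec i) (stdVec j)) := by
    rw [christoffel, Finset.mul_sum, hx.gram_eq]
    refine Finset.sum_congr rfl fun l _ => ?_
    rw [hx.partialD_metricCoeff, hx.partialD_metricCoeff, hx.partialD_metricCoeff,
      secondDeriv_comm hX (stdVec l) (stdVec i), secondDeriv_comm hX (stdVec l) (stdVec j),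
      secondDeriv_comm hX (stdVec j) (stdVec i), real_inner_comm (T (stdVec l))]
    ring
  have hb (s : Fin n) : inner ℝ (hessian g x p i j) (T (stdVec s)) = 0 := by
    change inner ℝ (secondDeriv X z (stdVec i) (stdVec j)
      - ∑ k, christoffel g p k i j • T (stdVec k)) (T (stdVec s)) = 0
    simp only [inner_sub_left, sum_inner, real_inner_smul_left, hΓ, Finset.sum_mul]
    rw [Finset.sum_comm]
    have h (l : Fin n) : ∑ k, (gramMatrix T)⁻¹ k l *
        inner ℝ (T (stdVec l)) (secondDeriv X z (stdVec i) (stdVec j)) *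
          inner ℝ (T (stdVec k)) (T (stdVec s))
        = inner ℝ (T (stdVec l)) (secondDeriv X z (stdVec i) (stdVec j)) *
          if l = s then 1 else 0 := by
      rw [← sum_gramMatrix_inv_mul hT, Finset.mul_sum]
      refine Finset.sum_congr rfl fun k _ => ?_
      rw [gramMatrix_inv_symm hT]
      ring
    simp only [h, mul_ite, mul_one, mul_zero, Finset.sum_ite_eq', Finset.mem_univ, if_true]
    rw [real_inner_comm, sub_self]
  rw [map_eq_sum_stdVec T v, inner_sum]
  exact Finset.sum_eq_zero fun s _ => by rw [real_inner_smul_right, hb, mul_zero]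

/-- The Laplacian defined by Christoffel symbols agrees with the description by normality, at the
centre of a chart. -/
lemma isLaplacianAt_laplacian_self (hx : IsIsometricImmersion g x) (p : M) :
    IsLaplacianAt (inChart p x) (extChartAt (𝓡 n) p p) (laplacian g x p) := by
  constructor
  · intro v
    simp only [laplacian, inner_neg_left, sum_inner, real_inner_smul_left,
      hx.inner_hessian_eq_zero, mul_zero, Finset.sum_const_zero, neg_zero]
  · refine ⟨∑ i, ∑ j, (gram g p)⁻¹ i j • ∑ k, christoffel g p k i j • stdVec k, ?_⟩
    have h (i j : Fin n) : secondDeriv (inChart p x) (extChartAt (𝓡 n) p p) (stdVec i) (stdVec j)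
        = hessian g x p i j + fderiv ℝ (inChart p x) (extChartAt (𝓡 n) p p)
          (∑ k, christoffel g p k i j • stdVec k) := by
      simp only [map_sum, map_smul]
      exact (sub_add_cancel _ _).symm
    rw [laplacian, gramTrace, ← hx.gram_eq]
    simp only [h, smul_add, Finset.sum_add_distrib, neg_add_cancel_left, map_sum, map_smul]

/-- The value of the Laplacian at a point can be computed in the chart at any nearby point. -/
lemma isLaplacianAt_laplacian (hx : IsIsometricImmersion g x) {p : M} {z : Euc n}
    (hz : z ∈ (extChartAt (𝓡 n) p).target) :
    IsLaplacianAt (inChart p x) z (inChart p (laplacian g x) z) := by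
  let q := (extChartAt (𝓡 n) p).symm z
  let t : Euc n → Euc n := fun w => extChartAt (𝓡 n) q ((extChartAt (𝓡 n) p).symm w)
  have ht : ContDiffAt ℝ ∞ t z := by
    rw [← contMDiffAt_iff_contDiffAt]
    exact (contMDiffAt_extChartAt (x := q)).comp z (contMDiffAt_extChartAt_symm hz)
  have hX : ContDiffAt ℝ ∞ (inChart q x) (t z) :=
    hx.contDiffAt_inChart (mem_extChartAt_target (I := 𝓡 n) q)
  have e : inChart p x =ᶠ[nhds z] inChart q x ∘ t := by
    have hc : ContinuousAt (extChartAt (𝓡 n) p).symm z :=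
      (contMDiffAt_extChartAt_symm hz).continuousAt
    filter_upwards [hc.eventually (extChartAt_source_mem_nhds (I := 𝓡 n) q)] with w hw
    change x _ = x _
    rw [(extChartAt (𝓡 n) q).left_inv hw]
  have inj : Function.Injective (fderiv ℝ (inChart q x ∘ t) z) := by
    rw [← e.fderiv_eq]
    exact hx.fderiv_inChart_injective hz
  have h := (hx.isLaplacianAt_laplacian_self q).comp (t := t) hX ht inj
  refine ⟨fun v => by rw [e.fderiv_eq]; exact h.1 v, ?_⟩
  rw [e.fderiv_eq, gramTrace_congr (secondDeriv_congr e)]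
  exact h.2

lemma contDiffAt_laplacian (hx : IsIsometricImmersion g x) {p : M} {z : Euc n}
    (hz : z ∈ (extChartAt (𝓡 n) p).target) : ContDiffAt ℝ ∞ (inChart p (laplacian g x)) z := by
  have hU := (isOpen_extChartAt_target (I := 𝓡 n) p).mem_nhds hz
  refine contDiffAt_of_isLaplacianAt (hx.contDiffAt_inChart hz) ?_ ?_
  · filter_upwards [hU] with q hq using hx.fderiv_inChart_injective hq
  · filter_upwards [hU] with q hq using hx.isLaplacianAt_laplacian hq

lemma mdifferentiableAt_laplacian (hx : IsIsometricImmersion g x) (p : M) :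
    MDifferentiableAt (𝓡 n) 𝓘(ℝ, Euc m) (laplacian g x) p := by
  have h := differentiableAt_of_contDiffAt
    (hx.contDiffAt_laplacian (mem_extChartAt_target (I := 𝓡 n) p))
  have h1 := h.mdifferentiableAt.comp p
    (mdifferentiableAt_extChartAt (I := 𝓡 n) (mem_chart_source _ p))
  refine h1.congr_of_eventuallyEq ?_
  filter_upwards [extChartAt_source_mem_nhds (I := 𝓡 n) p] with q hq
  change _ = laplacian g x _
  rw [(extChartAt (𝓡 n) p).left_inv hq]

lemma tangentImage_eq (hx : IsIsometricImmersion g x) (p : M) : tangentImage n x p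
    = LinearMap.range (fderiv ℝ (inChart p x) (extChartAt (𝓡 n) p p)).toLinearMap := by
  ext w
  refine exists_congr fun u => ?_
  exact iff_of_eq (congrArg (· = w) (mvfderiv_eq_fderiv_inChart (hx.mdifferentiableAt p) u))

lemma meanCurvatureVectorIn_eq (hx : IsIsometricImmersion g x) (W : Submodule ℝ (Euc m)) (p : M) :
    meanCurvatureVectorIn g W x p = (1 / (n : ℝ)) • (normalSpace n W x p).starProjection
      (gramTrace (fderiv ℝ (inChart p x) (extChartAt (𝓡 n) p p))
        (secondDeriv (inChart p x) (extChartAt (𝓡 n) p p))) := by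
  rw [meanCurvatureVectorIn]
  congr 1
  exact (hx.metricTrace_eq p _).trans (map_gramTrace
    (T := fderiv ℝ (inChart p x) (extChartAt (𝓡 n) p p))
    (normalSpace n W x p).starProjection.toLinearMap _).symm

/-- The trace of `D²x` has the same projection to the normal space as `-Δx`. -/
lemma meanCurvatureVectorIn_eq_laplacian (hx : IsIsometricImmersion g x)
    (W : Submodule ℝ (Euc m)) (p : M) : meanCurvatureVectorIn g W x p
      = -(1 / (n : ℝ)) • (normalSpace n W x p).starProjection (laplacian g x p) := by
  obtain ⟨u, hu⟩ := (hx.isLaplacianAt_laplacian_self p).exists_tangent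
  have h0 : (normalSpace n W x p).starProjection
      (fderiv ℝ (inChart p x) (extChartAt (𝓡 n) p p) u) = 0 := by
    rw [Submodule.starProjection_apply_eq_zero_iff, normalSpace, hx.tangentImage_eq]
    intro v hv
    rw [real_inner_comm]
    exact hv.2 _ ⟨u, rfl⟩
  rw [hx.meanCurvatureVectorIn_eq, eq_sub_of_add_eq' hu, map_sub, h0, zero_sub, smul_neg, neg_smul]

/-- Beltrami's formula `Δx = -nH`. -/
lemma laplacian_eq (hx : IsIsometricImmersion g x) (hn : 0 < n) :
    laplacian g x = fun p => (-(n : ℝ)) • meanCurvatureVector g x p := by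
  funext p
  have hn' : (n : ℝ) ≠ 0 := by positivity
  have h : laplacian g x p ∈ normalSpace n ⊤ x p := by
    refine ⟨trivial, ?_⟩
    rw [hx.tangentImage_eq]
    rintro _ ⟨v, rfl⟩
    rw [real_inner_comm]
    exact (hx.isLaplacianAt_laplacian_self p).inner_eq_zero v
  rw [meanCurvatureVector, hx.meanCurvatureVectorIn_eq_laplacian,
    Submodule.starProjection_eq_self_iff.2 h, smul_smul]
  field_simp
  simp

end IsIsometricImmersion

end Immersion

/-! ### From charts to the manifold -/

section Global

variable {n m : ℕ} {M : Type*} [TopologicalSpace M] [ChartedSpace (Euc n) M]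

lemma exists_eq_const_of_fderiv_inChart_eq_zero [ConnectedSpace M] {F : Type*}
    [NormedAddCommGroup F] [NormedSpace ℝ F] {f : M → F}
    (hd : ∀ p, ∀ z ∈ (extChartAt (𝓡 n) p).target, DifferentiableAt ℝ (inChart p f) z)
    (hf : ∀ p, ∀ z ∈ (extChartAt (𝓡 n) p).target, fderiv ℝ (inChart p f) z = 0) :
    ∃ k, ∀ p, f p = k := by
  have hloc : IsLocallyConstant f := by
    rw [IsLocallyConstant.iff_eventually_eq]
    intro p
    have hz := mem_extChartAt_target (I := 𝓡 n) p
    obtain ⟨ε, hε, hball⟩ := Metric.isOpen_iff.1 (isOpen_extChartAt_target (I := 𝓡 n) p) _ hz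
    filter_upwards [extChartAt_source_mem_nhds (I := 𝓡 n) p,
      (continuousAt_extChartAt (I := 𝓡 n) p).eventually (Metric.ball_mem_nhds _ hε)] with q hq hqb
    have h := Metric.isOpen_ball.is_const_of_fderiv_eq_zero (𝕜 := ℝ)
      (convex_ball (extChartAt (𝓡 n) p p) ε).isPreconnected
      (fun z hz => (hd p z (hball hz)).differentiableWithinAt) (fun z hz => hf p z (hball hz))
      hqb (Metric.mem_ball_self hε)
    simpa only [inChart, (extChartAt (𝓡 n) p).left_inv hq, extChartAt_to_inv] using h
  obtain ⟨p₀⟩ := (inferInstance : Nonempty M)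
  exact ⟨f p₀, fun p => hloc.apply_eq_of_preconnectedSpace p p₀⟩

lemma mvfderiv_smul_sub_const {F : Type*} [NormedAddCommGroup F] [NormedSpace ℝ F] {f : M → F}
    {p : M} (hf : MDifferentiableAt (𝓡 n) 𝓘(ℝ, F) f p) (r : ℝ) (a : F) (u : TangentSpace (𝓡 n) p) :
    mvfderiv (𝓡 n) (fun q => r • (f q - a)) p u = r • mvfderiv (𝓡 n) f p u := by
  have h1 : MDifferentiableAt (𝓡 n) 𝓘(ℝ, F) (fun q => f q - a) p := hf.sub mdifferentiableAt_const
  have h2 : mvfderiv (𝓡 n) (fun q => r • (f q - a)) p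
      = r • mvfderiv (𝓡 n) (fun q => f q - a) p := by
    simpa [mvfderiv_const] using mvfderiv_fun_smul (a := fun _ : M => r) mdifferentiableAt_const h1
  rw [h2, mvfderiv_fun_sub hf mdifferentiableAt_const]
  simp [mvfderiv_const]

variable [IsManifold (𝓡 n) ∞ M] {g : RiemMetric n M} {x : M → Euc m}

lemma mem_orthogonal_tangentImage_iff (hx : IsIsometricImmersion g x) (p : M) (w : Euc m) :
    w ∈ (tangentImage n x p)ᗮ ↔
      ∀ u, inner ℝ w (fderiv ℝ (inChart p x) (extChartAt (𝓡 n) p p) u) = 0 := by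
  rw [hx.tangentImage_eq]
  refine ⟨fun h u => ?_, ?_⟩
  · rw [real_inner_comm]
    exact h _ ⟨u, rfl⟩
  · rintro h _ ⟨u, rfl⟩
    rw [real_inner_comm]
    exact h u

/-- If the mean curvature vector is parallel, the differential of `Δx` is tangential. -/
lemma mvfderiv_laplacian_mem_tangentImage (hn : 0 < n) (hx : IsIsometricImmersion g x)
    (hH : HasParallelMeanCurvature g x) (p : M) (u : TangentSpace (𝓡 n) p) :
    mvfderiv (𝓡 n) (laplacian g x) p u ∈ tangentImage n x p := by
  have hn' : (n : ℝ) ≠ 0 := by positivity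
  have e : meanCurvatureVector g x = fun q => (-(n : ℝ))⁻¹ • laplacian g x q := by
    funext q
    rw [hx.laplacian_eq hn, smul_smul, inv_mul_cancel₀ (neg_ne_zero.2 hn'), one_smul]
  have hd : mvfderiv (𝓡 n) (meanCurvatureVector g x) p u
      = (-(n : ℝ))⁻¹ • mvfderiv (𝓡 n) (laplacian g x) p u := by
    rw [e]
    simpa using mvfderiv_smul_sub_const (hx.mdifferentiableAt_laplacian p) (-(n : ℝ))⁻¹ 0 u
  have h := hH p u
  rw [normalDerivative, Submodule.starProjection_apply_eq_zero_iff, normalSpace, top_inf_eq,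
    Submodule.orthogonal_orthogonal, hd] at h
  simpa [hn.ne'] using (tangentImage n x p).smul_mem (-(n : ℝ)) h

/-- The local result `fderiv_eq_smul_of_homothetic` in a chart of the manifold. -/
lemma fderiv_laplacian_eq_smul (hn : 0 < n) (hx : IsIsometricImmersion g x)
    (hH : HasParallelMeanCurvature g x) {c : ℝ} (hc : 0 < c)
    (hL : ∀ (p : M) (u v : TangentSpace (𝓡 n) p), inner ℝ (mvfderiv (𝓡 n) (laplacian g x) p u)
      (mvfderiv (𝓡 n) (laplacian g x) p v) = c ^ 2 * g.inner p u v)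
    (p : M) {z : Euc n} (hz : z ∈ (extChartAt (𝓡 n) p).target) :
    fderiv ℝ (inChart p (laplacian g x)) z = c • fderiv ℝ (inChart p x) z := by
  refine fderiv_eq_smul_of_homothetic (isOpen_extChartAt_target (I := 𝓡 n) p) hc
    (fun q hq => hx.contDiffAt_inChart hq) (fun q hq => hx.contDiffAt_laplacian hq)
    (fun q hq => hx.fderiv_inChart_injective hq)
    (fun q hq => (hx.isLaplacianAt_laplacian hq).inner_eq_zero) ?_ ?_
    (fun q hq => (hx.isLaplacianAt_laplacian hq).exists_tangent) hz
  · intro q hq u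
    obtain ⟨w, hw⟩ := mvfderiv_laplacian_mem_tangentImage hn hx hH ((extChartAt (𝓡 n) p).symm q)
      (mfderiv 𝓘(ℝ, Euc n) (𝓡 n) (extChartAt (𝓡 n) p).symm q u)
    obtain ⟨v, rfl⟩ := (mfderiv_extChartAt_symm_isInvertible hq).bijective.2 w
    exact ⟨v, ((fderiv_inChart hq (hx.mdifferentiableAt_laplacian _) u).trans hw.symm).trans
      (fderiv_inChart hq (hx.mdifferentiableAt _) v).symm⟩
  · intro q hq u v
    rw [fderiv_inChart hq (hx.mdifferentiableAt_laplacian _),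
      fderiv_inChart hq (hx.mdifferentiableAt_laplacian _),
      fderiv_inChart hq (hx.mdifferentiableAt _), fderiv_inChart hq (hx.mdifferentiableAt _),
      hL, hx.2]

/-! ### Homothetic Laplace transformations and minimal submanifolds of spheres -/

/-- From `dL = c dx`: `L = c (x - a)`, and `‖L‖` is constant since `L` is normal. -/
theorem isMinimalInHypersphere_of_isHomothetic [ConnectedSpace M] (hn : 0 < n)
    (hx : IsIsometricImmersion g x) (hH : HasParallelMeanCurvature g x)
    (h : IsHomothetic g (laplacian g x)) : IsMinimalInHypersphere g x := by
  obtain ⟨c, hc, hL⟩ := h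
  have hd := fun p z hz => fderiv_laplacian_eq_smul hn hx hH hc hL p (z := z) hz
  obtain ⟨k, hk⟩ := exists_eq_const_of_fderiv_inChart_eq_zero (n := n)
    (f := fun p => laplacian g x p - c • x p)
    (fun p z hz => (differentiableAt_of_contDiffAt (hx.contDiffAt_laplacian hz)).sub
      ((differentiableAt_of_contDiffAt (hx.contDiffAt_inChart hz)).const_smul c))
    (fun p z hz => by
      have h1 := (differentiableAt_of_contDiffAt (hx.contDiffAt_laplacian hz)).hasFDerivAt.sub
        ((differentiableAt_of_contDiffAt (hx.contDiffAt_inChart hz)).hasFDerivAt.const_smul c)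
      rw [hd p z hz, sub_self] at h1
      exact h1.fderiv)
  obtain ⟨K, hK⟩ := exists_eq_const_of_fderiv_inChart_eq_zero (n := n)
    (f := fun p => (inner ℝ (laplacian g x p) (laplacian g x p) : ℝ))
    (fun p z hz => (differentiableAt_of_contDiffAt (hx.contDiffAt_laplacian hz)).inner ℝ
      (differentiableAt_of_contDiffAt (hx.contDiffAt_laplacian hz)))
    (fun p z hz => by
      have hΛ := differentiableAt_of_contDiffAt (hx.contDiffAt_laplacian hz)
      have h0 := (hx.isLaplacianAt_laplacian hz).inner_eq_zero
      ext1 u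
      refine (fderiv_inner_apply ℝ hΛ hΛ u).trans ?_
      rw [hd p z hz]
      simp only [smul_apply, real_inner_smul_right, h0,
        real_inner_comm (inChart p (laplacian g x) z)]
      simp)
  let a : Euc m := -(c⁻¹ • k)
  have hLa (p : M) : laplacian g x p = c • (x p - a) := by
    rw [sub_eq_iff_eq_add.1 (hk p), sub_neg_eq_add, smul_add, smul_smul, mul_inv_cancel₀ hc.ne',
      one_smul, add_comm]
  have hnorm (p : M) : (c * ‖x p - a‖) ^ 2 = K := by
    rw [← hK p, real_inner_self_eq_norm_sq, hLa, norm_smul, Real.norm_of_nonneg hc.le]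
  -- the radius is positive, as `Δx` is an immersion of a manifold of positive dimension
  have hKpos : 0 < K := by
    obtain ⟨p₀⟩ := (inferInstance : Nonempty M)
    refine lt_of_le_of_ne (by rw [← hnorm p₀]; positivity) fun h0 => ?_
    have hL0 : laplacian g x = fun _ => 0 := by
      funext p
      have := hK p
      rwa [← h0, inner_self_eq_zero] at this
    let e : TangentSpace (𝓡 n) p₀ := (stdVec ⟨0, hn⟩ : Euc n)
    have he : e ≠ 0 := by
      have h1 : (stdVec ⟨0, hn⟩ : Euc n) ≠ 0 := by simp [stdVec]
      exact h1
    have h1 := hL p₀ e e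
    rw [hL0, mvfderiv_const] at h1
    have h2 := g.pos p₀ e he
    have h3 : 0 < c ^ 2 * g.inner p₀ e e := by positivity
    rw [← h1] at h3
    simp at h3
  refine ⟨a, Real.sqrt K / c, by positivity, fun p => ?_, fun p => ?_⟩
  · rw [mem_sphere_iff_norm, eq_div_iff hc.ne', ← hnorm p, Real.sqrt_sq (by positivity), mul_comm]
  · rw [hx.meanCurvatureVectorIn_eq_laplacian]
    have h0 : (normalSpace n (Submodule.span ℝ {x p - a})ᗮ x p).starProjection
        (laplacian g x p) = 0 := by
      rw [Submodule.starProjection_apply_eq_zero_iff]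
      rintro v ⟨hv, -⟩
      rw [hLa, inner_smul_right, real_inner_comm,
        (Submodule.mem_orthogonal_singleton_iff_inner_right).1 hv, mul_zero]
    rw [h0, smul_zero]

/-- Minimal submanifolds of the hypersphere with centre `a` and radius `r` satisfy
`Δx = (n / r²)(x - a)`. -/
lemma laplacian_eq_of_minimal_in_hypersphere (hn : 0 < n) (hx : IsIsometricImmersion g x)
    {a : Euc m} {r : ℝ} (hr : 0 < r) (hs : ∀ p, x p ∈ Metric.sphere a r)
    (hmin : ∀ p, meanCurvatureVectorIn g (Submodule.span ℝ {x p - a})ᗮ x p = 0) (p : M) :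
    laplacian g x p = ((n : ℝ) / r ^ 2) • (x p - a) := by
  have hz := mem_extChartAt_target (I := 𝓡 n) p
  have hU := isOpen_extChartAt_target (I := 𝓡 n) p
  have hX {z : Euc n} (hz : z ∈ (extChartAt (𝓡 n) p).target) := hx.contDiffAt_inChart hz
  have hXa {z : Euc n} (hz : z ∈ (extChartAt (𝓡 n) p).target) :
      ContDiffAt ℝ ∞ (fun w => inChart p x w - a) z := (hX hz).sub contDiffAt_const
  have dXa (z u : Euc n) : fderiv ℝ (fun w => inChart p x w - a) z u
      = fderiv ℝ (inChart p x) z u := by rw [fderiv_sub_const]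
  have hsq (q : M) : inner ℝ (x q - a) (x q - a) = r ^ 2 := by
    rw [real_inner_self_eq_norm_sq, mem_sphere_iff_norm.1 (hs q)]
  -- the position vector is normal
  have hpos : ∀ z ∈ (extChartAt (𝓡 n) p).target, ∀ u,
      inner ℝ (inChart p x z - a) (fderiv ℝ (inChart p x) z u) = 0 := by
    intro z hz u
    have h := inner_fderiv_add_inner_fderiv_eq_zero hU (fun w _ => hsq _) hz (hXa hz) (hXa hz) u
    change inner ℝ (fderiv ℝ (fun w => inChart p x w - a) z u) (inChart p x z - a)
      + inner ℝ (inChart p x z - a) (fderiv ℝ (fun w => inChart p x w - a) z u) = 0 at h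
    rw [dXa, real_inner_comm] at h
    linarith
  set z := extChartAt (𝓡 n) p p with hzdef
  have hxp : inChart p x z = x p := congrArg x (extChartAt_to_inv (I := 𝓡 n) p)
  have hlap := hx.isLaplacianAt_laplacian_self p
  have hinner : inner ℝ (x p - a) (laplacian g x p) = n := by
    obtain ⟨u, hu⟩ := hlap.exists_tangent
    rw [eq_sub_of_add_eq hu, inner_sub_right, ← hxp, hpos z hz, zero_sub, inner_gramTrace,
      ← gramTrace_inner_self (hx.fderiv_inChart_injective hz), ← neg_one_smul ℝ, ← gramTrace_smul]
    refine gramTrace_congr fun u v => ?_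
    have h := inner_fderiv_add_inner_fderiv_eq_zero hU (fun w hw => hpos w hw v) hz (hXa hz)
      (contDiffAt_fderiv_apply (hX hz) v) u
    rw [dXa] at h
    change (-1 : ℝ) * inner ℝ _ (fderiv ℝ (fun w => fderiv ℝ (inChart p x) w v) z u) = _
    linarith
  have hmean := hmin p
  have hn' : -(1 / (n : ℝ)) ≠ 0 := neg_ne_zero.2 (by positivity)
  rw [hx.meanCurvatureVectorIn_eq_laplacian, smul_eq_zero_iff_right hn',
    Submodule.starProjection_apply_eq_zero_iff] at hmean
  have hperp : inner ℝ (x p - a) (laplacian g x p - ((n : ℝ) / r ^ 2) • (x p - a)) = 0 := by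
    rw [inner_sub_right, inner_smul_right, hinner, hsq, div_mul_cancel₀ _ (by positivity), sub_self]
  have hmem : laplacian g x p - ((n : ℝ) / r ^ 2) • (x p - a)
      ∈ normalSpace n (Submodule.span ℝ {x p - a})ᗮ x p := by
    refine ⟨Submodule.mem_orthogonal_singleton_iff_inner_right.2 hperp, ?_⟩
    refine Submodule.sub_mem _ ((mem_orthogonal_tangentImage_iff hx p _).2 hlap.inner_eq_zero)
      (Submodule.smul_mem _ _ ((mem_orthogonal_tangentImage_iff hx p _).2 ?_))
    rw [← hxp]
    exact hpos z hz
  have h0 := hmean _ hmem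
  rw [← sub_eq_zero, ← inner_self_eq_zero (𝕜 := ℝ), inner_sub_right, h0, inner_smul_right,
    real_inner_comm, hperp, mul_zero, sub_zero]

theorem isHomothetic_of_isMinimalInHypersphere (hn : 0 < n) (hx : IsIsometricImmersion g x)
    (h : IsMinimalInHypersphere g x) : IsHomothetic g (laplacian g x) := by
  obtain ⟨a, r, hr, hs, hmin⟩ := h
  have hL : laplacian g x = fun p => ((n : ℝ) / r ^ 2) • (x p - a) :=
    funext (laplacian_eq_of_minimal_in_hypersphere hn hx hr hs hmin)
  refine ⟨(n : ℝ) / r ^ 2, by positivity, fun p u v => ?_⟩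
  have hd (u : TangentSpace (𝓡 n) p) : mvfderiv (𝓡 n) (laplacian g x) p u
      = ((n : ℝ) / r ^ 2) • mvfderiv (𝓡 n) x p u := by
    rw [hL]
    exact mvfderiv_smul_sub_const (hx.mdifferentiableAt p) _ a u
  rw [hd, hd, real_inner_smul_left, real_inner_smul_right, hx.2]
  ring

end Global

end LaplaceTransformation

theorem mainTheorem1 {n m : ℕ} (hn : 0 < n)
    {M : Type*} [TopologicalSpace M] [T2Space M] [SecondCountableTopology M] [ConnectedSpace M]
    [ChartedSpace (EuclideanSpace ℝ (Fin n)) M] [IsManifold (𝓡 n) ∞ M]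
    (g : LaplaceTransformation.RiemMetric n M) (x : M → EuclideanSpace ℝ (Fin m))
    (hx : LaplaceTransformation.IsIsometricImmersion g x)
    (hH : LaplaceTransformation.HasParallelMeanCurvature g x) :
    LaplaceTransformation.IsHomothetic g (LaplaceTransformation.laplacian g x) ↔
      LaplaceTransformation.IsMinimalInHypersphere g x :=
  ⟨LaplaceTransformation.isMinimalInHypersphere_of_isHomothetic hn hx hH,
    LaplaceTransformation.isHomothetic_of_isMinimalInHypersphere hn hx⟩
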